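/- Let $(R,\mathfrak m)$ be a one-dimensional Noetherian local domain with infinite residue field $k$ and quotient field $K$. Assume that the integral closure $\overline R$ of $R$ in $K$ is a finite $R$-module and a discrete valuation ring, and that $R$ is residually rational, i.e. the canonical map from $k$ to the residue field of $\overline R$ is an isomorphism. Assume that $R$ is Gorenstein (i.e. of finite injective dimension over itself). Write $H(n)=\ell_R(\mathfrak m^n/\mathfrak m^{n+1})$, let $h(z)\in\mathbb Z[z]$ be the polynomial with $\sum_{n\ge 0}H(n)z^n=h(z)/(1-z)$, and let $e=h(1)$ be the multiplicity and $\mu=\ell_R(\mathfrak m/\mathfrak m^2)$ the embedding dimension of $R$. Call $x\in\mathfrak m$ a minimal reduction of $\mathfrak m$ if $\mathfrak m^{n+1}=x\mathfrak m^n$ for all $n\gg0$, and let $\nu$ be the least integer such that $\mathfrak m^{n+1}=x\mathfrak m^n$ for all $n\ge\nu$. For $R$-submodules $A,B$ of $K$ put $A:B=\{y\in K\mid yB\subseteq A\}$, and let $\Lambda=\bigcup_{n\ge 0}(\mathfrak m^n:\mathfrak m^n)\subseteq K$ be the blowing-up of $R$ along $\mathfrak m$. Then minimal reductions of $\mathfrak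 m$ exist, and for every minimal reduction $x$ of $\mathfrak m$ the following conditions are equivalent: (1) $e=\mu+1$; (2) $\nu=2$; (3) $R:\Lambda=\mathfrak m^2$. -/

import Mathlib

noncomputable section

namespace BlowUp

open IsLocalRing

/-- A commutative ring has finite injective dimension as a module over itself. For Noetherian local
rings this is the definition of a Gorenstein ring. -/
def IsGorensteinLocal (R : Type*) [CommRing R] : Prop :=
  ∃ n : ℕ, CategoryTheory.HasInjectiveDimensionLE (ModuleCat.of R R) n

/-- `R` is residually rational: the canonical map from `R` to the residue field of its
integral closure in `K` is onto, i.e. the two residue fields coincide. -/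
def IsResiduallyRational (R K : Type*) [CommRing R] [Field K] [Algebra R K]
    [IsLocalRing (integralClosure R K)] : Prop :=
  Function.Surjective
    ((residue (integralClosure R K)).comp (algebraMap R (integralClosure R K)))

section Ideals

variable {R : Type*} [CommRing R]

/-- The Hilbert function `n ↦ ℓ_R(I ^ n / I ^ (n + 1))`. -/
def hilbertFunction (I : Ideal R) (n : ℕ) : ℕ :=
  (Module.length R (↥(I ^ n) ⧸ (I ^ (n + 1)).submoduleOf (I ^ n))).toNat

/-- The Hilbert-Poincaré series `∑ H_I(n) z ^ n`. -/
def hilbertSeries (I : Ideal R) : PowerSeries ℤ :=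
  PowerSeries.mk fun n => (hilbertFunction I n : ℤ)

/-- `h` is the h-polynomial of `I`: the Hilbert-Poincaré series is `h / (1 - z)`. -/
def IsHPolynomial (I : Ideal R) (h : Polynomial ℤ) : Prop :=
  (h : PowerSeries ℤ) = (1 - PowerSeries.X) * hilbertSeries I

open Classical in
/-- The h-polynomial of `I` (unique when it exists, and `0` otherwise). -/
def hPolynomial (I : Ideal R) : Polynomial ℤ :=
  if H : ∃ h, IsHPolynomial I h then H.choose else 0

/-- The multiplicity `e(I) = h_I(1)`. -/
def multiplicity (I : Ideal R) : ℤ := (hPolynomial I).eval 1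

/-- `x ∈ I` is a minimal reduction of `I`: `I ^ (n + 1) = x I ^ n` for all large `n`. -/
def IsMinimalReduction (I : Ideal R) (x : R) : Prop :=
  x ∈ I ∧ ∃ N : ℕ, ∀ n ≥ N, I ^ (n + 1) = Ideal.span {x} * I ^ n

/-- The least `N` such that `I ^ (n + 1) = x I ^ n` for all `n ≥ N`
(the reduction exponent of `I` when `x` is a minimal reduction of `I`). -/
def reductionExponent (I : Ideal R) (x : R) : ℕ :=
  sInf {N : ℕ | ∀ n ≥ N, I ^ (n + 1) = Ideal.span {x} * I ^ n}

variable (K : Type*) [Field K] [Algebra R K]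

/-- The blowing-up `⋃ n, I ^ n : I ^ n` inside `K`. Here `A / B` is the colon
`{x ∈ K | x B ⊆ A}`; the family is increasing, so the supremum is the union
(see `mem_blowup`). -/
def blowup (I : Ideal R) : Submodule R K :=
  ⨆ n : ℕ, IsLocalization.coeSubmodule K I ^ n / IsLocalization.coeSubmodule K I ^ n

theorem mem_blowup (I : Ideal R) (y : K) :
    y ∈ blowup K I ↔ ∃ n : ℕ, ∀ z ∈ IsLocalization.coeSubmodule K I ^ n,
      y * z ∈ IsLocalization.coeSubmodule K I ^ n := by
  have hmono : Monotone fun n : ℕ =>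
      IsLocalization.coeSubmodule K I ^ n / IsLocalization.coeSubmodule K I ^ n := by
    refine monotone_nat_of_le_succ fun n => ?_
    rw [Submodule.le_div_iff_mul_le, pow_succ, ← mul_assoc]
    exact mul_le_mul' (Submodule.le_div_iff_mul_le.mp le_rfl) le_rfl
  rw [blowup, Submodule.mem_iSup_of_directed _ hmono.directed_le]
  simp only [Submodule.mem_div_iff_forall_mul_mem]

end Ideals

/-- The embedding dimension `μ = ℓ_R(𝔪 / 𝔪 ^ 2)`. -/
def embeddingDim (R : Type*) [CommRing R] [IsLocalRing R] : ℕ :=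
  hilbertFunction (maximalIdeal R) 1

end BlowUp

end

/-! All three conditions are compared with the pair 𝔪³ ⊆ x𝔪, 𝔪² ⊄ x𝔪. Since e = ℓ(R/xR), the ideals
x𝔪 and 𝔪² have colengths e + 1 and μ + 1, so (1) says that 𝔪²/x𝔪 has length one. As xR ∩ 𝔪² = x𝔪,
the inclusion 𝔪³ ⊆ x𝔪 places 𝔪²/x𝔪 inside the socle of R/xR, which is one-dimensional because R is
Gorenstein (`socle_le_span`). With Nakayama, (1) becomes equivalent to the pair
(`IsMinimalReduction.covBy_iff`).

The hard point is that the pair forces 𝔪³ = x𝔪². Write 𝔪² = x𝔪 + Rs and s² = x(xp + cs) with p ∈ 𝔪.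
If c were a unit, s/x would be an integral root of T² - cT - p, which has two distinct roots modulo
𝔪; since the integral closure is local, s/x would lie in R, which is absurd. So c ∈ 𝔪, hence 𝔪⁴ ⊆
x²R. For xa ∈ 𝔪³ this makes a a socle element modulo x, and so a ∈ 𝔪².

If ν = 2, then x²Λ ⊆ 𝔪², whence 𝔪²Λ ⊆ R, and the socle argument gives equality. Conversely, 𝔪/x ⊆ Λ
turns R : Λ = 𝔪² back into the pair. -/

namespace BlowUp

open IsLocalRing CategoryTheory CategoryTheory.Abelian

universe u

/-! ### Finite injective dimension and the socle of R/xR -/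

section Gorenstein

variable {R : Type u} [CommRing R]

/-- The short complex `M → N → N / f(M)` attached to a linear map `f`. -/
abbrev cokernelComplex {M N : Type u} [AddCommGroup M] [Module R M] [AddCommGroup N] [Module R N]
    (f : M →ₗ[R] N) : ShortComplex (ModuleCat.{u} R) :=
  ModuleCat.shortComplexOfCompEqZero f (LinearMap.range f).mkQ (LinearMap.range_mkQ_comp f)

theorem cokernelComplex_shortExact {M N : Type u} [AddCommGroup M] [Module R M] [AddCommGroup N]
    [Module R N] {f : M →ₗ[R] N} (hf : Function.Injective f) : (cokernelComplex f).ShortExact :=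
  ModuleCat.shortComplex_shortExact _ (LinearMap.exact_map_mkQ_range f) hf
    (Submodule.mkQ_surjective _)

/-- The short complex `R → R → R / xR`. -/
abbrev mulComplex (x : R) : ShortComplex (ModuleCat.{u} R) :=
  ModuleCat.shortComplexOfCompEqZero (LinearMap.lsmul R R x)
    (Submodule.mkQ (Ideal.span {x})) (by
      ext
      simp)

theorem mulComplex_shortExact [IsDomain R] {x : R} (hx : x ≠ 0) : (mulComplex x).ShortExact := by
  refine ModuleCat.shortComplex_shortExact _ (fun y => ?_) (fun a b hab => ?_)
    (Submodule.mkQ_surjective _)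
  · change Submodule.Quotient.mk y = 0 ↔ _
    rw [Submodule.Quotient.mk_eq_zero, Ideal.mem_span_singleton']
    constructor
    · rintro ⟨a, rfl⟩
      exact ⟨a, mul_comm _ _⟩
    · rintro ⟨a, rfl⟩
      exact ⟨a, mul_comm _ _⟩
  · exact mul_left_cancel₀ hx hab

/-- Multiplication by x gives R/xR a free resolution of length one. -/
theorem ext_quotient_span_singleton_eq_zero [IsDomain R] {x : R} (hx : x ≠ 0)
    (Y : ModuleCat.{u} R) {i : ℕ} (hi : 2 ≤ i)
    (e : Ext (ModuleCat.of R (R ⧸ Ideal.span {x})) Y i) : e = 0 := by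
  obtain ⟨j, rfl⟩ : ∃ j, i = j + 1 + 1 := ⟨i - 2, by omega⟩
  obtain ⟨y, rfl⟩ := Ext.contravariant_sequence_exact₃ (mulComplex_shortExact hx) Y e
    (Ext.eq_zero_of_projective (P := ModuleCat.of R R) _) (n₀ := j + 1) (by omega)
  rw [Ext.eq_zero_of_projective (P := ModuleCat.of R R) y, Ext.comp_zero]

theorem ext_eq_zero_of_isFiniteLength (Y : ModuleCat.{u} R) (i : ℕ)
    (h : ∀ (S : Type u) [AddCommGroup S] [Module R S] [IsSimpleModule R S],
      ∀ e : Ext (ModuleCat.of R S) Y i, e = 0)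
    {M : Type u} [AddCommGroup M] [Module R M] (hM : IsFiniteLength R M)
    (e : Ext (ModuleCat.of R M) Y i) : e = 0 := by
  induction hM with
  | @of_subsingleton M _ _ _ =>
    have : 𝟙 (ModuleCat.of R M) = 0 := by
      ext m
      exact Subsingleton.elim (α := M) _ _
    rw [← Ext.mk₀_id_comp e, this, Ext.mk₀_zero, Ext.zero_comp]
  | @of_simple_quotient M _ _ N _ _ ih =>
    obtain ⟨y, rfl⟩ := Ext.contravariant_sequence_exact₂
      (LinearMap.shortExact_shortComplexKer (Submodule.mkQ_surjective N)) Y e (by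
        have key : ∀ P : Submodule R M, P = N → ∀ e : Ext (ModuleCat.of R P) Y i, e = 0 := by
          rintro _ rfl
          exact ih
        exact key _ N.ker_mkQ _)
    rw [h _ y, Ext.comp_zero]

/-- The map `R / 𝔪 → R / I` sending `1` to the class of `s`, when `𝔪 s ⊆ I`. -/
def socleMap [IsLocalRing R] (I : Ideal R) (s : R) (hs : ∀ a ∈ maximalIdeal R, a * s ∈ I) :
    (R ⧸ maximalIdeal R) →ₗ[R] R ⧸ I :=
  Submodule.liftQ (maximalIdeal R) (LinearMap.toSpanSingleton R (R ⧸ I) (Ideal.Quotient.mk I s))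
    fun a ha => by
      rw [LinearMap.mem_ker, LinearMap.toSpanSingleton_apply]
      exact (Ideal.Quotient.eq_zero_iff_mem).2 (hs a ha)

theorem socleMap_mk [IsLocalRing R] (I : Ideal R) (s : R) (hs : ∀ a ∈ maximalIdeal R, a * s ∈ I)
    (a : R) : socleMap I s hs (Submodule.Quotient.mk a) = Ideal.Quotient.mk I (a * s) :=
  rfl

theorem socleMap_injective [IsLocalRing R] (I : Ideal R) (s : R)
    (hs : ∀ a ∈ maximalIdeal R, a * s ∈ I) (hsI : s ∉ I) :
    Function.Injective (socleMap I s hs) := by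
  rw [injective_iff_map_eq_zero]
  intro y hy
  obtain ⟨a, rfl⟩ := Submodule.Quotient.mk_surjective _ y
  rw [socleMap_mk, Ideal.Quotient.eq_zero_iff_mem] at hy
  rw [Submodule.Quotient.mk_eq_zero]
  by_contra ha
  obtain ⟨b, hb⟩ := (IsLocalRing.notMem_maximalIdeal.1 ha).exists_left_inv
  apply hsI
  have := I.mul_mem_left b hy
  rwa [← mul_assoc, hb, one_mul] at this

/-- Modules of finite length over a Gorenstein local domain that has a regular parameter `x`
have no second extensions by the ring. -/
theorem ext_two_eq_zero [IsDomain R] [IsLocalRing R] (hGor : IsGorensteinLocal R) {x s : R}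
    (hx : x ≠ 0) (hfin : IsFiniteLength R (R ⧸ Ideal.span {x})) (hsx : s ∉ Ideal.span {x})
    (hs : ∀ a ∈ maximalIdeal R, a * s ∈ Ideal.span {x})
    {M : Type u} [AddCommGroup M] [Module R M] (hM : IsFiniteLength R M)
    (e : Ext (ModuleCat.of R M) (ModuleCat.of R R) 2) : e = 0 := by
  obtain ⟨n, hn⟩ := hGor
  -- Descending induction on the degree i, starting above the injective dimension; d bounds how far
  -- i lies below n + 1.
  suffices H : ∀ d i : ℕ, 2 ≤ i → n + 1 ≤ i + d → ∀ (M : Type u) [AddCommGroup M] [Module R M],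
      IsFiniteLength R M → ∀ e : Ext (ModuleCat.of R M) (ModuleCat.of R R) i, e = 0 from
    H (n + 1) 2 le_rfl (by omega) M hM e
  intro d
  induction d with
  | zero =>
    intro i _ hi M _ _ _ e
    exact e.eq_zero_of_hasInjectiveDimensionLT (n + 1) hi
  | succ d ih =>
    intro i hi hid M _ _ hM e
    refine ext_eq_zero_of_isFiniteLength _ i (fun S _ _ _ e => ?_) hM e
    obtain ⟨I, hI, ⟨φ⟩⟩ := isSimpleModule_iff_quot_maximal.mp
      (inferInstance : IsSimpleModule R S)
    obtain rfl := IsLocalRing.eq_maximalIdeal hI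
    -- The simple module embeds in R/xR through the socle element s. Its `Ext` in degree i sits
    -- between that of R/xR, zero since i ≥ 2, and that of the cokernel in degree i + 1, zero by
    -- induction.
    have hf : Function.Injective (socleMap _ s hs ∘ₗ φ.toLinearMap) :=
      (socleMap_injective _ s hs hsx).comp φ.injective
    obtain ⟨y, rfl⟩ := Ext.contravariant_sequence_exact₁ (cokernelComplex_shortExact hf) _ e
      (n₁ := i + 1) (by omega)
      (ih (i + 1) (by omega) (by omega) _ (hfin.of_surjective (Submodule.mkQ_surjective _)) _)
    rw [ext_quotient_span_singleton_eq_zero hx _ hi y, Ext.comp_zero]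

/-- In a Gorenstein local domain, a parameter `x` with `R / xR` of finite length generates an ideal
with one-dimensional socle. -/
theorem socle_le_span [IsDomain R] [IsLocalRing R] (hGor : IsGorensteinLocal R) {x s t : R}
    (hx : x ≠ 0) (hxm : x ∈ maximalIdeal R)
    (hfin : IsFiniteLength R (R ⧸ Ideal.span {x})) (hsx : s ∉ Ideal.span {x})
    (hs : ∀ a ∈ maximalIdeal R, a * s ∈ Ideal.span {x})
    (ht : ∀ a ∈ maximalIdeal R, a * t ∈ Ideal.span {x}) :
    ∃ a : R, t - a * s ∈ Ideal.span {x} := by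
  have hT := mulComplex_shortExact hx
  have hS := cokernelComplex_shortExact (socleMap_injective _ s hs hsx)
  let g : ModuleCat.of R (R ⧸ maximalIdeal R) ⟶ ModuleCat.of R (R ⧸ Ideal.span {x}) :=
    ModuleCat.ofHom (socleMap _ t ht)
  let ι : ModuleCat.of R (R ⧸ maximalIdeal R) ⟶ ModuleCat.of R (R ⧸ Ideal.span {x}) :=
    ModuleCat.ofHom (socleMap _ s hs)
  -- The obstruction to extending the class of g along ι lies in `Ext` of degree 2 of a
  -- finite-length module, so it vanishes.
  obtain ⟨ξ, hξ⟩ := Ext.contravariant_sequence_exact₁ hS _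
    ((Ext.mk₀ g).comp hT.extClass (zero_add 1)) (n₁ := 2) (by omega)
    (ext_two_eq_zero hGor hx hfin hsx hs (hfin.of_surjective (Submodule.mkQ_surjective _)) _)
  have hxξ : ξ.comp (Ext.mk₀ (mulComplex x).f) (add_zero 1) = 0 := by
    have h0 : x • 𝟙 (ModuleCat.of R (R ⧸ Ideal.span {x})) = 0 := by
      ext
      change (Ideal.Quotient.mk (Ideal.span {x})) (x * 1) = 0
      rw [Ideal.Quotient.eq_zero_iff_mem, mul_one]
      exact Ideal.mem_span_singleton_self x
    have h1 : ξ.comp (Ext.mk₀ (mulComplex x).f) (add_zero 1) = x • ξ :=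
      (Ext.smul_eq_comp_mk₀ ξ x).symm
    rw [h1, ← Ext.mk₀_id_comp ξ, ← Ext.smul_comp, ← Ext.mk₀_smul]
    erw [h0]
    rw [Ext.mk₀_zero, Ext.zero_comp]
  -- Being killed by x, ξ is the connecting image of an endomorphism h of R/xR. The difference ι ≫ h
  -- - g then lifts to a map R/𝔪 → R, necessarily zero, so h sends s to t and h(1) is the required
  -- coefficient.
  obtain ⟨ζ, hζ⟩ := Ext.covariant_sequence_exact₁ _ hT ξ hxξ (zero_add 1)
  obtain ⟨h, rfl⟩ := Ext.homEquiv₀.symm.surjective ζ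
  have hcomp : (Ext.mk₀ (ι ≫ h - g)).comp hT.extClass (zero_add 1) = 0 := by
    have hgξ : (Ext.mk₀ g).comp hT.extClass (zero_add 1) =
        (Ext.mk₀ (ι ≫ h)).comp hT.extClass (zero_add 1) := by
      rw [← hξ, ← hζ, ← Ext.mk₀_comp_mk₀]
      exact (Ext.comp_assoc_of_second_deg_zero _ _ _ _).symm
    rw [sub_eq_add_neg, Ext.mk₀_add, Ext.add_comp, Ext.mk₀_neg, Ext.neg_comp, hgξ, add_neg_cancel]
  obtain ⟨q, hq⟩ := Ext.covariant_sequence_exact₃ _ hT _ _ hcomp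
  obtain ⟨q, rfl⟩ := Ext.homEquiv₀.symm.surjective q
  have hq0 : q = 0 := by
    have hq1 : ∀ y : R ⧸ maximalIdeal R, x • (q.hom y : R) = 0 := by
      intro y
      have : x • y = 0 := by
        obtain ⟨a, rfl⟩ := Submodule.Quotient.mk_surjective _ y
        rw [← Submodule.Quotient.mk_smul, Submodule.Quotient.mk_eq_zero]
        exact Ideal.mul_mem_right _ _ hxm
      have h2 := q.hom.map_smul x y
      rw [this, map_zero] at h2
      exact h2.symm
    refine ModuleCat.hom_ext (LinearMap.ext fun y => ?_)
    exact (mul_eq_zero.1 (hq1 y)).resolve_left hx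
  have hg : ι ≫ h = g := by
    rw [hq0, Ext.homEquiv₀_symm_apply, Ext.mk₀_zero, Ext.zero_comp] at hq
    have h0 : ι ≫ h - g = 0 := Ext.homEquiv₀.symm.injective (by
      rw [Ext.homEquiv₀_symm_apply, Ext.homEquiv₀_symm_apply, Ext.mk₀_zero]
      exact hq.symm)
    exact sub_eq_zero.1 h0
  let h' : (R ⧸ Ideal.span {x}) →ₗ[R] (R ⧸ Ideal.span {x}) := h.hom
  obtain ⟨a, ha⟩ := Ideal.Quotient.mk_surjective (h' (Ideal.Quotient.mk _ 1))
  refine ⟨a, ?_⟩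
  have h1 : h' (socleMap _ s hs (Submodule.Quotient.mk 1)) =
      socleMap _ t ht (Submodule.Quotient.mk 1) :=
    LinearMap.congr_fun (congrArg ModuleCat.Hom.hom hg) (Submodule.Quotient.mk 1)
  have h2 : Ideal.Quotient.mk (Ideal.span {x}) (1 * s) =
      s • Ideal.Quotient.mk (Ideal.span {x}) 1 := by
    rw [one_mul, Algebra.smul_def, map_one, mul_one]
    rfl
  rw [socleMap_mk, socleMap_mk, h2, map_smul, ← ha, one_mul] at h1
  rw [← Ideal.Quotient.eq, ← h1, map_mul, mul_comm, Algebra.smul_def]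
  rfl

end Gorenstein

end BlowUp

namespace BlowUp

open IsLocalRing

/-! ### Colengths of ideals -/

section Length

variable {R : Type*} [CommRing R]

/-- The colength `ℓ_R(R / I)`, with the value `0` when it is infinite. -/
noncomputable def colength (I : Ideal R) : ℕ := (Module.length R (R ⧸ I)).toNat

theorem colength_top : colength (⊤ : Ideal R) = 0 := by
  rw [colength, Module.length_eq_zero_iff.2 (Submodule.Quotient.subsingleton_iff.2 rfl)]
  rfl

theorem length_quotient_eq_add {I J : Ideal R} (h : J ≤ I) :
    Module.length R (R ⧸ J) =
      Module.length R (I ⧸ J.submoduleOf I) + Module.length R (R ⧸ I) := by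
  refine Module.length_eq_add_of_exact (Submodule.mapQ (J.submoduleOf I) J I.subtype le_rfl)
    (Submodule.factor h) ?_ (Submodule.factor_surjective h) ?_
  · rw [injective_iff_map_eq_zero]
    intro y hy
    obtain ⟨a, rfl⟩ := Submodule.Quotient.mk_surjective _ y
    exact (Submodule.Quotient.mk_eq_zero _).2 ((Submodule.Quotient.mk_eq_zero J).1 hy)
  · intro y
    obtain ⟨a, rfl⟩ := Submodule.Quotient.mk_surjective _ y
    refine (Submodule.Quotient.mk_eq_zero _).trans ⟨?_, ?_⟩
    · intro ha
      exact ⟨Submodule.Quotient.mk ⟨a, ha⟩, rfl⟩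
    · rintro ⟨z, hz⟩
      obtain ⟨b, rfl⟩ := Submodule.Quotient.mk_surjective _ z
      have := I.sub_mem b.2 (h ((Submodule.Quotient.eq J).1 hz))
      simpa using this

/-- Multiplication by x identifies R/I with xR/xI. -/
theorem length_quotient_span_singleton_mul [IsDomain R] {x : R} (hx : x ≠ 0) (I : Ideal R) :
    Module.length R (R ⧸ Ideal.span {x} * I) =
      Module.length R (R ⧸ I) + Module.length R (R ⧸ Ideal.span {x}) := by
  refine Module.length_eq_add_of_exact
    (Submodule.mapQ I (Ideal.span {x} * I) (LinearMap.lsmul R R x) fun a ha =>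
      Ideal.mul_mem_mul (Ideal.mem_span_singleton_self x) ha)
    (Submodule.factor Ideal.mul_le_left) ?_ (Submodule.factor_surjective _) ?_
  · rw [injective_iff_map_eq_zero]
    intro y hy
    obtain ⟨a, rfl⟩ := Submodule.Quotient.mk_surjective _ y
    obtain ⟨b, hb, hab⟩ :=
      Ideal.mem_span_singleton_mul.1 ((Submodule.Quotient.mk_eq_zero (Ideal.span {x} * I)).1 hy)
    rw [Submodule.Quotient.mk_eq_zero, ← mul_left_cancel₀ hx hab]
    exact hb
  · intro y
    obtain ⟨a, rfl⟩ := Submodule.Quotient.mk_surjective _ y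
    refine (Submodule.Quotient.mk_eq_zero _).trans ⟨?_, ?_⟩
    · intro ha
      obtain ⟨b, rfl⟩ := Ideal.mem_span_singleton'.1 ha
      exact ⟨Submodule.Quotient.mk b, congrArg Submodule.Quotient.mk (mul_comm x b)⟩
    · rintro ⟨z, hz⟩
      obtain ⟨b, rfl⟩ := Submodule.Quotient.mk_surjective _ z
      replace hz := (Submodule.Quotient.eq (Ideal.span {x} * I)).1 hz
      have h1 : x * b ∈ Ideal.span {x} := Ideal.mul_mem_right _ _ (Ideal.mem_span_singleton_self x)
      have := (Ideal.span {x}).sub_mem h1 (Ideal.mul_le_left hz)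
      simpa using this

variable [IsDomain R] [IsNoetherianRing R] [Ring.KrullDimLE 1 R]

theorem isFiniteLength_quotient {I : Ideal R} (hI : I ≠ ⊥) : IsFiniteLength R (R ⧸ I) := by
  obtain ⟨x, hxI, hx⟩ := Submodule.exists_mem_ne_zero_of_ne_bot hI
  have h : Ideal.span {x} ≤ I := (Ideal.span_singleton_le_iff_mem I).2 hxI
  exact (isFiniteLength_quotient_span_singleton R (mem_nonZeroDivisors_of_ne_zero hx)).of_surjective
    (Submodule.factor_surjective h)

theorem coe_colength {I : Ideal R} (hI : I ≠ ⊥) :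
    (colength I : ℕ∞) = Module.length R (R ⧸ I) :=
  ENat.natCast_toNat (Module.length_ne_top_iff.2 (isFiniteLength_quotient hI))

theorem length_submodule_quotient_add_colength {I J : Ideal R} (hJ : J ≠ ⊥) (h : J ≤ I) :
    Module.length R (I ⧸ J.submoduleOf I) + colength I = colength J := by
  rw [coe_colength hJ, coe_colength (ne_bot_of_le_ne_bot hJ h), length_quotient_eq_add h]

theorem colength_span_singleton_mul {x : R} (hx : x ≠ 0) {I : Ideal R} (hI : I ≠ ⊥) :
    colength (Ideal.span {x} * I) = colength I + colength (Ideal.span {x}) := by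
  have hx' : Ideal.span {x} ≠ ⊥ := by simpa using hx
  apply ENat.natCast_inj.1
  push_cast
  rw [coe_colength (mul_ne_zero hx' hI), coe_colength hI, coe_colength hx',
    length_quotient_span_singleton_mul hx]

theorem hilbertFunction_add_colength {I : Ideal R} (hI : I ≠ ⊥) (n : ℕ) :
    hilbertFunction I n + colength (I ^ n) = colength (I ^ (n + 1)) := by
  have h := length_submodule_quotient_add_colength (pow_ne_zero (n + 1) hI)
    (Ideal.pow_le_pow_right (I := I) n.le_succ)
  have hfin : Module.length R (↥(I ^ n) ⧸ (I ^ (n + 1)).submoduleOf (I ^ n)) ≠ ⊤ := by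
    intro htop
    rw [htop, top_add] at h
    exact ENat.natCast_ne_top _ h.symm
  rw [← ENat.natCast_toNat hfin] at h
  exact_mod_cast h

theorem covBy_iff_colength {I J : Ideal R} (hJ : J ≠ ⊥) (h : J ≤ I) :
    J ⋖ I ↔ colength J = colength I + 1 := by
  have hadd := length_submodule_quotient_add_colength hJ h
  rw [covBy_iff_quot_is_simple h, ← Module.length_eq_one_iff]
  change Module.length R (I ⧸ J.submoduleOf I) = 1 ↔ _
  constructor
  · intro h1
    rw [h1] at hadd
    have : 1 + colength I = colength J := by exact_mod_cast hadd
    omega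
  · intro h1
    rw [h1, Nat.cast_add, add_comm (colength I : ℕ∞)] at hadd
    exact_mod_cast (ENat.add_left_injective_of_ne_top (ENat.natCast_ne_top (colength I))) hadd

theorem colength_maximalIdeal [IsLocalRing R] (hm : maximalIdeal R ≠ ⊥) :
    colength (maximalIdeal R) = 1 := by
  have h := (covBy_iff_colength hm le_top).1 (covBy_top_iff.2 (maximalIdeal.isMaximal R).out)
  rwa [colength_top] at h

end Length

/-! ### Multiplicity as the eventual value of the Hilbert function -/

section Multiplicity

open PowerSeries in
theorem multiplicity_eq_of_hilbertFunction_eq {R : Type*} [CommRing R] {I : Ideal R} {c N : ℕ}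
    (h : ∀ n ≥ N, hilbertFunction I n = c) : multiplicity I = c := by
  -- The tail of the series is c zᴺ/(1 - z); the truncated part disappears at z = 1.
  let q : Polynomial ℤ := (1 - Polynomial.X) * trunc N (hilbertSeries I) +
    Polynomial.C (c : ℤ) * Polynomial.X ^ N
  have hS : hilbertSeries I = (trunc N (hilbertSeries I) : PowerSeries ℤ) +
      X ^ N * (PowerSeries.C (c : ℤ) * PowerSeries.mk 1) := by
    ext n
    rw [map_add, coeff_X_pow_mul', Polynomial.coeff_coe, coeff_trunc]
    by_cases hn : n < N
    · rw [if_pos hn, if_neg (by omega), add_zero]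
    · rw [if_neg hn, if_pos (by omega), zero_add, coeff_C_mul, coeff_mk, Pi.one_apply, mul_one,
        hilbertSeries, coeff_mk, h n (by omega)]
  have hq : IsHPolynomial I q := by
    rw [IsHPolynomial, hS]
    have h1 : (1 - X : PowerSeries ℤ) * PowerSeries.mk 1 = 1 := by
      rw [mul_comm, mk_one_mul_one_sub_eq_one]
    have h2 : (q : PowerSeries ℤ) = (1 - X) * (trunc N (hilbertSeries I) : PowerSeries ℤ) +
        PowerSeries.C (c : ℤ) * X ^ N := by
      simp only [q, Polynomial.coe_add, Polynomial.coe_mul, Polynomial.coe_sub, Polynomial.coe_one,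
        Polynomial.coe_X, Polynomial.coe_pow, Polynomial.coe_C]
    rw [h2]
    linear_combination (-(PowerSeries.C (c : ℤ) * X ^ N)) * h1
  have hex : ∃ p, IsHPolynomial I p := ⟨q, hq⟩
  have hpq : hPolynomial I = q := by
    rw [hPolynomial, dif_pos hex]
    exact Polynomial.coe_injective ℤ (hex.choose_spec.trans hq.symm)
  rw [multiplicity, hpq]
  simp [q]

end Multiplicity

end BlowUp

namespace BlowUp

open IsLocalRing

/-! ### Existence of minimal reductions -/

section Existence

/-- If `R` embeds into a discrete valuation ring that is a finite `R`-module, then an element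
of `I` of least value is a minimal reduction of `I`. -/
theorem exists_isMinimalReduction {R V : Type*} [CommRing R] [IsNoetherianRing R] [CommRing V]
    [IsDomain V] [IsDiscreteValuationRing V] [Algebra R V] [Module.Finite R V]
    (hinj : Function.Injective (algebraMap R V)) (I : Ideal R) :
    ∃ x : R, IsMinimalReduction I x := by
  obtain ⟨x, hxI, hmin⟩ : ∃ x ∈ I, ∀ a ∈ I, algebraMap R V x ∣ algebraMap R V a := by
    let S : Set ℕ∞ := (fun a : R => IsDiscreteValuationRing.addVal V (algebraMap R V a)) '' I
    have hS : S.Nonempty := ⟨_, 0, I.zero_mem, rfl⟩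
    obtain ⟨x, hx, hxS⟩ := wellFounded_lt.min_mem S hS
    refine ⟨x, hx, fun a ha => IsDiscreteValuationRing.addVal_le_iff_dvd.1 ?_⟩
    have := wellFounded_lt.not_lt_min S (x := IsDiscreteValuationRing.addVal V (algebraMap R V a))
      ⟨a, ha, rfl⟩
    rw [← hxS, not_lt] at this
    exact this
  by_cases hx0 : x = 0
  · refine ⟨x, hxI, 0, fun n _ => ?_⟩
    have hI : I = ⊥ := by
      refine (Submodule.eq_bot_iff I).2 fun a ha => hinj ?_
      have := hmin a ha
      rw [hx0, map_zero, zero_dvd_iff] at this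
      rw [this, map_zero]
    rw [hx0, hI]
    rw [pow_succ, Ideal.mul_bot, Set.singleton_zero, Ideal.span_zero, Ideal.bot_mul]
  have hxV : algebraMap R V x ≠ 0 := (map_ne_zero_iff _ hinj).2 hx0
  have hdvd : ∀ n : ℕ, ∀ a ∈ I ^ n, algebraMap R V x ^ n ∣ algebraMap R V a := by
    intro n a ha
    have h1 : I.map (algebraMap R V) ≤ Ideal.span {algebraMap R V x} :=
      Ideal.map_le_iff_le_comap.2 fun b hb => Ideal.mem_span_singleton.2 (hmin b hb)
    have h2 := Ideal.pow_right_mono h1 n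
    rw [← Ideal.map_pow, Ideal.span_singleton_pow] at h2
    exact Ideal.mem_span_singleton.1 (h2 (Ideal.mem_map_of_mem _ ha))
  -- L n is x⁻ⁿIⁿ, a submodule of V because x has least value in I. The chain increases and
  -- stabilizes, and L (n + 1) = L n is the reduction equation.
  let L : ℕ →o Submodule R V :=
    { toFun := fun n => Submodule.comap (LinearMap.mulLeft R (algebraMap R V x ^ n))
        (Submodule.map (Algebra.linearMap R V) (I ^ n))
      monotone' := monotone_nat_of_le_succ fun n v => by
        rintro ⟨a, ha, hav⟩
        refine ⟨x * a, ?_, ?_⟩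
        · rw [pow_succ']
          exact Ideal.mul_mem_mul hxI ha
        · change algebraMap R V (x * a) = algebraMap R V x ^ (n + 1) * v
          change algebraMap R V a = algebraMap R V x ^ n * v at hav
          rw [map_mul, hav]
          ring }
  have : IsNoetherian R V := isNoetherian_of_isNoetherianRing_of_finite R V
  obtain ⟨N, hN⟩ := monotone_stabilizes_iff_noetherian.2 this L
  refine ⟨x, hxI, N, fun n hn => le_antisymm (fun a ha => ?_) ?_⟩
  · obtain ⟨v, hv⟩ := hdvd (n + 1) a ha
    have hvL : v ∈ L (n + 1) := ⟨a, ha, hv⟩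
    rw [← hN (n + 1) (by omega), hN n hn] at hvL
    obtain ⟨b, hb, hbv⟩ := hvL
    change algebraMap R V b = algebraMap R V x ^ n * v at hbv
    refine Ideal.mem_span_singleton_mul.2 ⟨b, hb, hinj ?_⟩
    rw [map_mul, hbv, hv]
    ring
  · rw [pow_succ']
    exact Ideal.mul_mono_left ((Ideal.span_singleton_le_iff_mem I).2 hxI)

end Existence

/-! ### Quadratic equations over a ring with local integral closure -/

section QuadraticRoot

/-- Over a local domain whose integral closure `V` is local, a quadratic equation
with reduction `T (T - c)`, `c ≠ 0`, has no roots in `V` outside `R`. -/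
theorem mem_range_of_quadratic {R V : Type*} [CommRing R] [IsLocalRing R] [CommRing V]
    [IsLocalRing V] [Algebra R V] [Algebra.IsIntegral R V] {t : V} {c p : R} (hc : IsUnit c)
    (hp : p ∈ maximalIdeal R) (ht : t * t = algebraMap R V c * t + algebraMap R V p) :
    t ∈ (algebraMap R V).range := by
  have hunit : ∀ b, IsUnit (1 - p * b) := fun b => by
    by_contra hb
    have := Ideal.add_mem _ ((mem_maximalIdeal _).2 hb) (Ideal.mul_mem_right b _ hp)
    rw [sub_add_cancel] at this
    exact (Ideal.ne_top_iff_one _).1 (maximalIdeal.isMaximal R).ne_top this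
  let B := Algebra.adjoin R {t}
  have hB : ∀ y ∈ B, ∃ a b : R, y = algebraMap R V a + algebraMap R V b * t := by
    intro y hy
    induction hy using Algebra.adjoin_induction with
    | mem y hy =>
      obtain rfl := hy
      exact ⟨0, 1, by simp⟩
    | algebraMap r => exact ⟨r, 0, by simp⟩
    | add y z _ _ hy hz =>
      obtain ⟨a, b, rfl⟩ := hy
      obtain ⟨a', b', rfl⟩ := hz
      exact ⟨a + a', b + b', by simp only [map_add]; ring⟩
    | mul y z _ _ hy hz =>
      obtain ⟨a, b, rfl⟩ := hy
      obtain ⟨a', b', rfl⟩ := hz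
      refine ⟨a * a' + b * b' * p, a * b' + b * a' + b * b' * c, ?_⟩
      simp only [map_add, map_mul]
      linear_combination (algebraMap R V b * algebraMap R V b') * ht
  have htB : t ∈ B := Algebra.subset_adjoin rfl
  have : Algebra.IsIntegral B V := Algebra.IsIntegral.tower_top R
  -- V is integral over B = R + Rt, so an element of B that is a unit in V has its inverse in B.
  have hinv : ∀ u ∈ B, IsUnit u → ∃ a b : R, u * (algebraMap R V a + algebraMap R V b * t) = 1 := by
    intro u hu huV
    have : IsUnit (⟨u, hu⟩ : B) := IsLocalHom.map_nonunit (f := algebraMap B V) _ huV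
    obtain ⟨w, hw⟩ := this.exists_right_inv
    obtain ⟨a, b, hab⟩ := hB w w.2
    exact ⟨a, b, by rw [← hab]; exact congrArg Subtype.val hw⟩
  -- As V is local, t or c - t is a unit. Since t(t - c) = p, the other one is ±p(a + bt), a linear
  -- equation for t that is solvable in R because 1 ∓ pb is a unit.
  have hsum : IsUnit (t + (algebraMap R V c - t)) := by
    rw [add_sub_cancel]
    exact hc.map _
  rcases isUnit_or_isUnit_of_isUnit_add hsum with h | h
  · obtain ⟨a, b, hab⟩ := hinv t htB h
    obtain ⟨d, hd⟩ := (hunit b).exists_left_inv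
    have hd' : algebraMap R V d * (1 - algebraMap R V p * algebraMap R V b) = 1 := by
      simpa only [map_mul, map_sub, map_one] using congrArg (algebraMap R V) hd
    refine ⟨d * (c + p * a), ?_⟩
    simp only [map_add, map_mul]
    have h1 : t - algebraMap R V c =
        algebraMap R V p * (algebraMap R V a + algebraMap R V b * t) := by
      linear_combination (algebraMap R V a + algebraMap R V b * t) * ht -
        (t - algebraMap R V c) * hab
    linear_combination t * hd' - algebraMap R V d * h1
  · obtain ⟨a, b, hab⟩ := hinv _ (B.sub_mem (B.algebraMap_mem c) htB) h
    obtain ⟨d, hd⟩ := (hunit (-b)).exists_left_inv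
    have hd' : algebraMap R V d * (1 - algebraMap R V p * (-algebraMap R V b)) = 1 := by
      simpa only [map_mul, map_sub, map_one, map_neg] using congrArg (algebraMap R V) hd
    refine ⟨d * (-(p * a)), ?_⟩
    simp only [map_neg, map_mul]
    have h1 : t = -(algebraMap R V p * (algebraMap R V a + algebraMap R V b * t)) := by
      linear_combination -(algebraMap R V a + algebraMap R V b * t) * ht - t * hab
    linear_combination t * hd' - algebraMap R V d * h1

end QuadraticRoot

end BlowUp

namespace BlowUp

open IsLocalRing

/-! ### Minimal reductions of 𝔪 and the cube of 𝔪 -/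

section MinimalReduction

variable {R : Type*} [CommRing R]

theorem pow_succ_eq_of_eq {I : Ideal R} {x : R} {N : ℕ} (h : I ^ (N + 1) = Ideal.span {x} * I ^ N) :
    ∀ n ≥ N, I ^ (n + 1) = Ideal.span {x} * I ^ n := by
  intro n hn
  induction n, hn using Nat.le_induction with
  | base => exact h
  | succ n _ ih => rw [pow_succ, ih, mul_assoc, ← pow_succ, ih]

theorem pow_add_eq_of_forall {I : Ideal R} {x : R} {N : ℕ}
    (h : ∀ n ≥ N, I ^ (n + 1) = Ideal.span {x} * I ^ n) (k : ℕ) :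
    I ^ (N + k) = Ideal.span {x ^ k} * I ^ N := by
  induction k with
  | zero => simp
  | succ k ih =>
    rw [← add_assoc, h _ (by omega), ih, ← mul_assoc, Ideal.span_singleton_mul_span_singleton,
      pow_succ']

variable [IsLocalRing R]

local notation "𝔪" => maximalIdeal R

theorem IsMinimalReduction.mul_le_sq {x : R} (hx : IsMinimalReduction 𝔪 x) :
    Ideal.span {x} * 𝔪 ≤ 𝔪 ^ 2 := by
  rw [pow_two]
  exact Ideal.mul_mono_left ((Ideal.span_singleton_le_iff_mem _).2 hx.1)

theorem reductionExponent_eq_two_iff {x : R} (hx : IsMinimalReduction 𝔪 x) :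
    reductionExponent 𝔪 x = 2 ↔
      𝔪 ^ 3 = Ideal.span {x} * 𝔪 ^ 2 ∧ ¬ 𝔪 ^ 2 ≤ Ideal.span {x} * 𝔪 := by
  constructor
  · intro h
    have hne : {N : ℕ | ∀ n ≥ N, 𝔪 ^ (n + 1) = Ideal.span {x} * 𝔪 ^ n}.Nonempty := hx.2
    have hmem := Nat.sInf_mem hne
    change ∀ n ≥ reductionExponent 𝔪 x, _ at hmem
    rw [h] at hmem
    refine ⟨hmem 2 le_rfl, fun h2 => ?_⟩
    have h1 : reductionExponent 𝔪 x ≤ 1 := Nat.sInf_le (pow_succ_eq_of_eq (N := 1) (by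
      rw [pow_one]
      exact le_antisymm h2 hx.mul_le_sq))
    omega
  · rintro ⟨h3, h2⟩
    refine le_antisymm (Nat.sInf_le (pow_succ_eq_of_eq h3)) (le_csInf hx.2 fun N hN => ?_)
    by_contra hlt
    refine h2 ?_
    -- Both N = 0 and N = 1 give the equation at n = 1.
    have := hN 1 (by omega)
    rw [pow_one] at this
    exact this.le

variable [IsNoetherianRing R]

/-- The ideal 𝔪³ + x𝔪 lies between x𝔪 and 𝔪², and by Nakayama it cannot be 𝔪². -/
theorem pow_three_le_of_covBy {x : R} (h : Ideal.span {x} * 𝔪 ⋖ 𝔪 ^ 2) :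
    𝔪 ^ 3 ≤ Ideal.span {x} * 𝔪 := by
  have h3 : 𝔪 ^ 3 ≤ 𝔪 ^ 2 := Ideal.pow_le_pow_right (by omega)
  rcases h.eq_or_eq (le_sup_right : _ ≤ 𝔪 ^ 3 ⊔ Ideal.span {x} * 𝔪) (sup_le h3 h.le) with h1 | h1
  · exact h1 ▸ le_sup_left
  · exfalso
    refine h.lt.not_ge (Submodule.le_of_le_smul_of_le_jacobson_bot (I := 𝔪)
      (IsNoetherian.noetherian _) (maximalIdeal_le_jacobson _) ?_)
    rw [smul_eq_mul, ← pow_succ', sup_comm]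
    exact h1.ge

variable [IsDomain R]

theorem pow_ne_pow_succ (hm : 𝔪 ≠ ⊥) (n : ℕ) : ¬ 𝔪 ^ n ≤ 𝔪 ^ (n + 1) := by
  intro h
  refine pow_ne_zero n hm ?_
  refine Submodule.eq_bot_of_le_smul_of_le_jacobson_bot 𝔪 (𝔪 ^ n) (IsNoetherian.noetherian _) ?_
    (maximalIdeal_le_jacobson _)
  rwa [smul_eq_mul, ← pow_succ']

/-- Otherwise 𝔪ᴺ⁺ᵏ = xᵏ𝔪ᴺ would lie in the next power of 𝔪, against Nakayama. -/
theorem IsMinimalReduction.pow_notMem (hm : 𝔪 ≠ ⊥) {x : R} (hx : IsMinimalReduction 𝔪 x) (k : ℕ) :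
    x ^ k ∉ 𝔪 ^ (k + 1) := by
  intro hk
  obtain ⟨-, N, hN⟩ := hx
  refine pow_ne_pow_succ hm (N + k) ?_
  rw [pow_add_eq_of_forall hN]
  refine (Ideal.mul_mono_left ((Ideal.span_singleton_le_iff_mem _).2 hk)).trans ?_
  rw [← pow_add]
  exact Ideal.pow_le_pow_right (by omega)

theorem IsMinimalReduction.ne_zero (hm : 𝔪 ≠ ⊥) {x : R} (hx : IsMinimalReduction 𝔪 x) : x ≠ 0 := by
  rintro rfl
  refine hx.pow_notMem hm 1 ?_
  rw [pow_one]
  exact Ideal.zero_mem _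

/-- `xR ∩ 𝔪 ^ 2 = x𝔪` -/
theorem IsMinimalReduction.mem_mul_of_mem (hm : 𝔪 ≠ ⊥) {x : R} (hx : IsMinimalReduction 𝔪 x)
    {a : R} (hax : a ∈ Ideal.span {x}) (ha : a ∈ 𝔪 ^ 2) : a ∈ Ideal.span {x} * 𝔪 := by
  obtain ⟨b, rfl⟩ := Ideal.mem_span_singleton'.1 hax
  refine Ideal.mem_span_singleton_mul.2 ⟨b, ?_, mul_comm x b⟩
  by_contra hb
  have hbu := notMem_maximalIdeal.1 hb
  refine hx.pow_notMem hm 1 ?_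
  rw [pow_one]
  exact (Ideal.unit_mul_mem_iff_mem _ hbu).1 ha

/-- For large n, 𝔪ⁿ⁺¹ = x𝔪ⁿ has colength larger by ℓ(R/xR) than that of 𝔪ⁿ. -/
theorem multiplicity_eq_colength [Ring.KrullDimLE 1 R] (hm : 𝔪 ≠ ⊥) {x : R}
    (hx : IsMinimalReduction 𝔪 x) : multiplicity 𝔪 = colength (Ideal.span {x}) := by
  obtain ⟨N, hN⟩ := hx.2
  refine multiplicity_eq_of_hilbertFunction_eq (N := N) fun n hn => ?_
  have h := hilbertFunction_add_colength hm n
  rw [hN n hn, colength_span_singleton_mul (hx.ne_zero hm) (pow_ne_zero n hm)] at h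
  omega

theorem multiplicity_eq_embeddingDim_add_one_iff [Ring.KrullDimLE 1 R] (hm : 𝔪 ≠ ⊥) {x : R}
    (hx : IsMinimalReduction 𝔪 x) :
    multiplicity 𝔪 = (embeddingDim R : ℤ) + 1 ↔ Ideal.span {x} * 𝔪 ⋖ 𝔪 ^ 2 := by
  have hx0 := hx.ne_zero hm
  have hx' : Ideal.span {x} ≠ ⊥ := by simpa using hx0
  have h := hilbertFunction_add_colength hm 1
  rw [pow_one, colength_maximalIdeal hm] at h
  rw [multiplicity_eq_colength hm hx, covBy_iff_colength (mul_ne_zero hx' hm) hx.mul_le_sq,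
    colength_span_singleton_mul hx0 hm, colength_maximalIdeal hm, embeddingDim]
  norm_num at h ⊢
  omega

variable [Ring.KrullDimLE 1 R] {x : R}

theorem IsMinimalReduction.exists_sub_mul_mem (hm : 𝔪 ≠ ⊥) (hGor : IsGorensteinLocal R)
    (hx : IsMinimalReduction 𝔪 x) (h3 : 𝔪 ^ 3 ≤ Ideal.span {x} * 𝔪) {s : R}
    (hs : s ∈ 𝔪 ^ 2) (hsx : s ∉ Ideal.span {x} * 𝔪) {t : R}
    (ht : ∀ a ∈ 𝔪, a * t ∈ Ideal.span {x}) : ∃ a : R, t - a * s ∈ Ideal.span {x} := by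
  have hx0 := hx.ne_zero hm
  refine socle_le_span hGor hx0 hx.1 (isFiniteLength_quotient (by simpa using hx0))
    (fun h => hsx (hx.mem_mul_of_mem hm h hs)) (fun a ha => ?_) ht
  refine Ideal.mul_le_left (h3 ?_)
  rw [pow_succ']
  exact Ideal.mul_mem_mul ha hs

theorem IsMinimalReduction.exists_sub_mul_mem_of_mem_sq (hm : 𝔪 ≠ ⊥) (hGor : IsGorensteinLocal R)
    (hx : IsMinimalReduction 𝔪 x) (h3 : 𝔪 ^ 3 ≤ Ideal.span {x} * 𝔪) {s : R}
    (hs : s ∈ 𝔪 ^ 2) (hsx : s ∉ Ideal.span {x} * 𝔪) {t : R} (ht : t ∈ 𝔪 ^ 2) :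
    ∃ a : R, t - a * s ∈ Ideal.span {x} * 𝔪 := by
  obtain ⟨a, ha⟩ := hx.exists_sub_mul_mem hm hGor h3 hs hsx (t := t) fun a ha =>
    Ideal.mul_le_left (h3 (by
      rw [pow_succ']
      exact Ideal.mul_mem_mul ha ht))
  exact ⟨a, hx.mem_mul_of_mem hm ha (Ideal.sub_mem _ ht (Ideal.mul_mem_left _ _ hs))⟩

theorem IsMinimalReduction.covBy_iff (hm : 𝔪 ≠ ⊥) (hGor : IsGorensteinLocal R)
    (hx : IsMinimalReduction 𝔪 x) :
    Ideal.span {x} * 𝔪 ⋖ 𝔪 ^ 2 ↔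
      𝔪 ^ 3 ≤ Ideal.span {x} * 𝔪 ∧ ¬ 𝔪 ^ 2 ≤ Ideal.span {x} * 𝔪 := by
  refine ⟨fun h => ⟨pow_three_le_of_covBy h, h.lt.not_ge⟩, fun ⟨h3, h2⟩ => ?_⟩
  refine ⟨lt_of_le_not_ge hx.mul_le_sq h2, fun J hJ hJ2 => hJ2.not_ge fun t ht => ?_⟩
  -- Any s ∈ 𝔪² outside x𝔪 generates 𝔪² modulo x𝔪, by one-dimensionality of the socle.
  obtain ⟨s, hsJ, hsx⟩ := SetLike.exists_of_lt hJ
  obtain ⟨a, ha⟩ := hx.exists_sub_mul_mem_of_mem_sq hm hGor h3 (hJ2.le hsJ) hsx ht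
  have := J.add_mem (hJ.le ha) (J.mul_mem_left a hsJ)
  rwa [sub_add_cancel] at this

/-- Here `V` is the integral closure of `R` in its fraction field `K`. -/
theorem IsMinimalReduction.pow_four_le {V : Type*} [CommRing V] [IsDomain V] [IsLocalRing V]
    [Algebra R V] [Algebra.IsIntegral R V] (K : Type*) [Field K] [Algebra R K] [IsFractionRing R K]
    [Algebra V K] [IsScalarTower R V K] [IsIntegralClosure V R K]
    (hm : 𝔪 ≠ ⊥) (hGor : IsGorensteinLocal R) (hx : IsMinimalReduction 𝔪 x)
    (h3 : 𝔪 ^ 3 ≤ Ideal.span {x} * 𝔪) : 𝔪 ^ 4 ≤ Ideal.span {x ^ 2} := by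
  by_cases h2 : 𝔪 ^ 2 ≤ Ideal.span {x} * 𝔪
  · have := Ideal.mul_mono (h2.trans Ideal.mul_le_left) (h2.trans Ideal.mul_le_left)
    rwa [← pow_add, Ideal.span_singleton_mul_span_singleton, ← pow_two] at this
  have hx0 := hx.ne_zero hm
  obtain ⟨s, hs, hsx⟩ := Set.not_subset.1 h2
  have hsx' : s ∉ Ideal.span {x} := fun h => hsx (hx.mem_mul_of_mem hm h hs)
  have hms : ∀ a ∈ 𝔪, ∃ d ∈ 𝔪, a * s = x * d := by
    intro a ha
    have : a * s ∈ Ideal.span {x} * 𝔪 := h3 (by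
      rw [pow_succ']
      exact Ideal.mul_mem_mul ha hs)
    obtain ⟨d, hd, h⟩ := Ideal.mem_span_singleton_mul.1 this
    exact ⟨d, hd, h.symm⟩
  have hdec : ∀ t ∈ 𝔪 ^ 2, ∃ c, ∃ p ∈ 𝔪, t = x * p + c * s := by
    intro t ht
    obtain ⟨c, hc⟩ := hx.exists_sub_mul_mem_of_mem_sq hm hGor h3 hs hsx ht
    obtain ⟨p, hp, h⟩ := Ideal.mem_span_singleton_mul.1 hc
    exact ⟨c, p, hp, by rw [h]; ring⟩
  have hss : ∃ d, s * s = x ^ 2 * d := by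
    have h4 : s * s ∈ Ideal.span {x} * 𝔪 ^ 2 := by
      have h5 : 𝔪 ^ 2 * 𝔪 ^ 2 ≤ Ideal.span {x} * 𝔪 ^ 2 := by
        calc 𝔪 ^ 2 * 𝔪 ^ 2 = 𝔪 ^ 3 * 𝔪 := by ring
          _ ≤ Ideal.span {x} * 𝔪 * 𝔪 := Ideal.mul_mono_left h3
          _ = _ := by ring
      exact h5 (Ideal.mul_mem_mul hs hs)
    obtain ⟨w, hw, hsw⟩ := Ideal.mem_span_singleton_mul.1 h4
    obtain ⟨c, p, hp, rfl⟩ := hdec w hw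
    by_cases hc : c ∈ 𝔪
    · obtain ⟨d, -, hd⟩ := hms c hc
      exact ⟨p + d, by rw [← hsw, hd]; ring⟩
    · exfalso
      have hxK : algebraMap R K x ≠ 0 := by simpa using hx0
      -- Dividing s² = x(xp + cs) by x² gives t² = ct + p.
      let t : K := algebraMap R K s / algebraMap R K x
      have htt : t * t = algebraMap R K c * t + algebraMap R K p := by
        have := congrArg (algebraMap R K) hsw
        simp only [map_mul, map_add] at this
        simp only [t]
        field_simp
        linear_combination -this
      have hint : IsIntegral R t := by
        refine ⟨Polynomial.X ^ 2 - (Polynomial.C c * Polynomial.X + Polynomial.C p),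
          Polynomial.monic_X_pow_sub Polynomial.degree_linear_lt, ?_⟩
        simp only [Polynomial.eval₂_sub, Polynomial.eval₂_add, Polynomial.eval₂_mul,
          Polynomial.eval₂_X_pow, Polynomial.eval₂_C, Polynomial.eval₂_X]
        linear_combination htt
      obtain ⟨v, hv⟩ := (IsIntegralClosure.isIntegral_iff (A := V)).1 hint
      have hvv : v * v = algebraMap R V c * v + algebraMap R V p := by
        apply IsIntegralClosure.algebraMap_injective V R K
        simp only [map_mul, map_add, hv, ← IsScalarTower.algebraMap_apply]
        exact htt
      obtain ⟨r, hr⟩ := mem_range_of_quadratic (notMem_maximalIdeal.1 hc) hp hvv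
      apply hsx'
      refine Ideal.mem_span_singleton'.2 ⟨r, IsFractionRing.injective R K ?_⟩
      rw [map_mul, IsScalarTower.algebraMap_apply R V K r, hr, hv]
      exact div_mul_cancel₀ _ hxK
  obtain ⟨d, hd⟩ := hss
  rw [show 4 = 2 + 2 from rfl, pow_add, Ideal.mul_le]
  intro a ha b hb
  obtain ⟨c, p, hp, rfl⟩ := hdec a ha
  obtain ⟨c', p', hp', rfl⟩ := hdec b hb
  obtain ⟨q, -, hq⟩ := hms p hp
  obtain ⟨q', -, hq'⟩ := hms p' hp'
  -- Expand (xp + cs)(xp' + c's) using ps = xq, p's = xq' and s² = x²d.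
  refine Ideal.mem_span_singleton'.2 ⟨p * p' + q * c' + q' * c + d * c * c', ?_⟩
  linear_combination -(x * c') * hq - (x * c) * hq' - (c * c') * hd

theorem IsMinimalReduction.pow_three_eq {V : Type*} [CommRing V] [IsDomain V] [IsLocalRing V]
    [Algebra R V] [Algebra.IsIntegral R V] (K : Type*) [Field K] [Algebra R K] [IsFractionRing R K]
    [Algebra V K] [IsScalarTower R V K] [IsIntegralClosure V R K]
    (hm : 𝔪 ≠ ⊥) (hGor : IsGorensteinLocal R) (hx : IsMinimalReduction 𝔪 x)
    (h3 : 𝔪 ^ 3 ≤ Ideal.span {x} * 𝔪) (h2 : ¬ 𝔪 ^ 2 ≤ Ideal.span {x} * 𝔪) :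
    𝔪 ^ 3 = Ideal.span {x} * 𝔪 ^ 2 := by
  have hx0 := hx.ne_zero hm
  have hle : Ideal.span {x} * 𝔪 ^ 2 ≤ 𝔪 ^ 3 := by
    rw [pow_succ' 𝔪 2]
    exact Ideal.mul_mono_left ((Ideal.span_singleton_le_iff_mem _).2 hx.1)
  refine le_antisymm (fun y hy => ?_) hle
  have h4 := hx.pow_four_le (V := V) K hm hGor h3
  obtain ⟨s, hs, hsx⟩ := Set.not_subset.1 h2
  obtain ⟨a, ha, rfl⟩ := Ideal.mem_span_singleton_mul.1 (h3 hy)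
  obtain ⟨c, hc⟩ := hx.exists_sub_mul_mem hm hGor h3 hs hsx (t := a) fun b hb => by
    have : b * (x * a) ∈ Ideal.span {x ^ 2} := h4 (by
      rw [pow_succ']
      exact Ideal.mul_mem_mul hb hy)
    obtain ⟨d, hd⟩ := Ideal.mem_span_singleton'.1 this
    refine Ideal.mem_span_singleton'.2 ⟨d, mul_left_cancel₀ hx0 ?_⟩
    linear_combination hd
  obtain ⟨r, hr⟩ := Ideal.mem_span_singleton'.1 hc
  have hcs : c * s ∈ 𝔪 ^ 2 := Ideal.mul_mem_left _ _ hs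
  obtain rfl : a = r * x + c * s := by rw [hr]; ring
  refine Ideal.mul_mem_mul (Ideal.mem_span_singleton_self x) (Ideal.add_mem _ ?_ hcs)
  rw [pow_two]
  refine Ideal.mul_mem_mul ?_ hx.1
  -- If r were a unit, rx² = xa - xcs ∈ 𝔪³ would force x² ∈ 𝔪³.
  by_contra hru
  refine hx.pow_notMem hm 2 ((Ideal.unit_mul_mem_iff_mem _ (notMem_maximalIdeal.1 hru)).1 ?_)
  have := Ideal.sub_mem _ hy (hle (Ideal.mul_mem_mul (Ideal.mem_span_singleton_self x) hcs))
  convert this using 1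
  ring

end MinimalReduction

end BlowUp

namespace BlowUp

open IsLocalRing

/-! ### The blowing-up and its conductor R : Λ -/

section Conductor

variable {R : Type*} [CommRing R] (K : Type*) [Field K] [Algebra R K]

theorem coeSubmodule_pow (I : Ideal R) (n : ℕ) :
    IsLocalization.coeSubmodule K I ^ n = IsLocalization.coeSubmodule K (I ^ n) := by
  induction n with
  | zero => rw [pow_zero, pow_zero, Ideal.one_eq_top, IsLocalization.coeSubmodule_top]
  | succ n ih => rw [pow_succ, ih, ← IsLocalization.coeSubmodule_mul, ← pow_succ]

theorem mem_blowup_iff (I : Ideal R) (y : K) :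
    y ∈ blowup K I ↔
      ∃ n : ℕ, ∀ a ∈ I ^ n, ∃ b ∈ I ^ n, algebraMap R K b = y * algebraMap R K a := by
  simp only [mem_blowup, coeSubmodule_pow, IsLocalization.mem_coeSubmodule,
    forall_exists_index, and_imp, forall_apply_eq_imp_iff₂]

theorem one_mem_blowup (I : Ideal R) : (1 : K) ∈ blowup K I :=
  (mem_blowup_iff K I 1).2 ⟨0, fun a ha => ⟨a, ha, (one_mul _).symm⟩⟩

theorem mem_one_div_iff (M : Submodule R K) (z : K) :
    z ∈ (1 : Submodule R K) / M ↔ ∀ y ∈ M, ∃ r, algebraMap R K r = z * y := by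
  simp only [Submodule.mem_div_iff_forall_mul_mem, Submodule.mem_one]

variable [FaithfulSMul R K] {x : R}

theorem IsMinimalReduction.div_mem_blowup {I : Ideal R} (hx0 : x ≠ 0)
    (hx : IsMinimalReduction I x) {a : R} {k : ℕ} (ha : a ∈ I ^ k) :
    algebraMap R K a / algebraMap R K x ^ k ∈ blowup K I := by
  have hxK : algebraMap R K x ≠ 0 := by simpa using hx0
  obtain ⟨-, N, hN⟩ := hx
  refine (mem_blowup_iff K I _).2 ⟨N, fun b hb => ?_⟩
  have hab : b * a ∈ I ^ (N + k) := by
    rw [pow_add]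
    exact Ideal.mul_mem_mul hb ha
  rw [pow_add_eq_of_forall hN] at hab
  obtain ⟨c, hc, hcab⟩ := Ideal.mem_span_singleton_mul.1 hab
  refine ⟨c, hc, ?_⟩
  have := congrArg (algebraMap R K) hcab
  rw [map_mul, map_mul, map_pow] at this
  field_simp
  linear_combination this

/-- If `I ^ (n + 1) = x I ^ n` for `n ≥ N`, then `x ^ N Λ ⊆ I ^ N`. -/
theorem exists_of_mem_blowup {I : Ideal R} {N : ℕ} (hx0 : x ≠ 0) (hxI : x ∈ I)
    (h : ∀ n ≥ N, I ^ (n + 1) = Ideal.span {x} * I ^ n) {y : K} (hy : y ∈ blowup K I) :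
    ∃ w ∈ I ^ N, algebraMap R K w = y * algebraMap R K x ^ N := by
  have hxK : algebraMap R K x ≠ 0 := by simpa using hx0
  obtain ⟨n, hn⟩ := (mem_blowup_iff K _ y).1 hy
  -- The exponent n stabilized by y is unrelated to N, so pass to Iᴺ⁺ⁿ = xⁿIᴺ and cancel xⁿ.
  have key : ∀ a ∈ I ^ N * I ^ n, ∃ b ∈ I ^ N * I ^ n, algebraMap R K b = y * algebraMap R K a := by
    intro a ha
    induction ha using Submodule.mul_induction_on' with
    | mem_mul_mem c hc d hd =>
      obtain ⟨b, hb, hby⟩ := hn d hd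
      exact ⟨c * b, Ideal.mul_mem_mul hc hb, by rw [map_mul, map_mul, hby]; ring⟩
    | add c _ d _ hc hd =>
      obtain ⟨b, hb, hby⟩ := hc
      obtain ⟨b', hb', hby'⟩ := hd
      exact ⟨b + b', Ideal.add_mem _ hb hb', by rw [map_add, map_add, hby, hby']; ring⟩
  obtain ⟨b, hb, hby⟩ := key (x ^ N * x ^ n)
    (Ideal.mul_mem_mul (Ideal.pow_mem_pow hxI N) (Ideal.pow_mem_pow hxI n))
  rw [← pow_add, pow_add_eq_of_forall h] at hb
  obtain ⟨w, hw, rfl⟩ := Ideal.mem_span_singleton_mul.1 hb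
  refine ⟨w, hw, mul_left_cancel₀ (pow_ne_zero n hxK) ?_⟩
  rw [map_mul, map_mul, map_pow, map_pow] at hby
  linear_combination hby

variable [IsLocalRing R] [IsDomain R] [IsNoetherianRing R]

local notation "𝔪" => maximalIdeal R

/-- Multiplying 𝔪² by 𝔪/x ⊆ Λ stays in R, so 𝔪³ ⊆ xR ∩ 𝔪² = x𝔪. If 𝔪² = x𝔪, then xΛ ⊆ 𝔪, so x would
lie in R : Λ = 𝔪². -/
theorem IsMinimalReduction.pow_three_le_of_conductor_eq (hm : 𝔪 ≠ ⊥)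
    (hx : IsMinimalReduction 𝔪 x)
    (h : (1 : Submodule R K) / blowup K 𝔪 = IsLocalization.coeSubmodule K 𝔪 ^ 2) :
    𝔪 ^ 3 ≤ Ideal.span {x} * 𝔪 ∧ ¬ 𝔪 ^ 2 ≤ Ideal.span {x} * 𝔪 := by
  have hx0 := hx.ne_zero hm
  have hxK : algebraMap R K x ≠ 0 := by simpa using hx0
  rw [coeSubmodule_pow] at h
  constructor
  · rw [pow_succ, Ideal.mul_le]
    intro z hz a ha
    have hza : z * a ∈ 𝔪 ^ 2 := Ideal.mul_mem_right _ _ hz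
    refine hx.mem_mul_of_mem hm ?_ hza
    have hz' : algebraMap R K z ∈ (1 : Submodule R K) / blowup K 𝔪 := by
      rw [h]
      exact (IsLocalization.mem_coeSubmodule _ _).2 ⟨z, hz, rfl⟩
    obtain ⟨r, hr⟩ := (mem_one_div_iff K _ _).1 hz' _
      (hx.div_mem_blowup K hx0 (k := 1) (by rwa [pow_one] : a ∈ 𝔪 ^ 1))
    refine Ideal.mem_span_singleton'.2 ⟨r, FaithfulSMul.algebraMap_injective R K ?_⟩
    rw [map_mul, hr, map_mul, pow_one]
    field_simp
  · intro h2
    have hall := pow_succ_eq_of_eq (I := 𝔪) (x := x) (N := 1) (by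
      rw [pow_one]
      exact le_antisymm h2 hx.mul_le_sq)
    have hxC : algebraMap R K x ∈ (1 : Submodule R K) / blowup K 𝔪 := by
      rw [mem_one_div_iff]
      intro y hy
      obtain ⟨w, -, hw⟩ := exists_of_mem_blowup K hx0 hx.1 hall hy
      exact ⟨w, by rw [hw, pow_one, mul_comm]⟩
    rw [h] at hxC
    obtain ⟨w, hw, hwx⟩ := (IsLocalization.mem_coeSubmodule _ _).1 hxC
    obtain rfl := FaithfulSMul.algebraMap_injective R K hwx
    refine hx.pow_notMem hm 1 ?_
    rwa [pow_one]

theorem IsMinimalReduction.conductor_eq [Ring.KrullDimLE 1 R] (hm : 𝔪 ≠ ⊥)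
    (hGor : IsGorensteinLocal R) (hx : IsMinimalReduction 𝔪 x) (h3 : 𝔪 ^ 3 = Ideal.span {x} * 𝔪 ^ 2)
    (h2 : ¬ 𝔪 ^ 2 ≤ Ideal.span {x} * 𝔪) :
    (1 : Submodule R K) / blowup K 𝔪 = IsLocalization.coeSubmodule K 𝔪 ^ 2 := by
  have hx0 := hx.ne_zero hm
  have hxK : algebraMap R K x ≠ 0 := by simpa using hx0
  have hall := pow_succ_eq_of_eq h3
  have h4 : 𝔪 ^ 4 = Ideal.span {x ^ 2} * 𝔪 ^ 2 := pow_add_eq_of_forall hall 2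
  have h3' : 𝔪 ^ 3 ≤ Ideal.span {x} * 𝔪 := 
    h3.trans_le (Ideal.mul_mono_right (Ideal.pow_le_self two_ne_zero))
  have hsq : ∀ q ∈ 𝔪 ^ 2, algebraMap R K q ∈ (1 : Submodule R K) / blowup K 𝔪 := by
    intro q hq
    rw [mem_one_div_iff]
    intro y hy
    obtain ⟨w, hw, hwy⟩ := exists_of_mem_blowup K hx0 hx.1 hall hy
    have hqw : q * w ∈ 𝔪 ^ 4 := by
      rw [show 4 = 2 + 2 from rfl, pow_add]
      exact Ideal.mul_mem_mul hq hw
    rw [h4] at hqw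
    obtain ⟨r, -, hr⟩ := Ideal.mem_span_singleton_mul.1 hqw
    refine ⟨r, mul_left_cancel₀ (pow_ne_zero 2 hxK) ?_⟩
    have := congrArg (algebraMap R K) hr
    rw [map_mul, map_mul, map_pow, hwy] at this
    linear_combination this
  rw [coeSubmodule_pow]
  apply le_antisymm
  · intro z hz
    have hz' := (mem_one_div_iff K _ z).1 hz
    obtain ⟨c, hc⟩ := hz' 1 (one_mem_blowup K _)
    rw [mul_one] at hc
    subst hc
    obtain ⟨s, hs, hsx⟩ := Set.not_subset.1 h2
    obtain ⟨a, ha⟩ := hx.exists_sub_mul_mem hm hGor h3' hs hsx (t := c) fun b hb => by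
      obtain ⟨r, hr⟩ := hz' _ (hx.div_mem_blowup K hx0 (k := 1) (by rwa [pow_one] : b ∈ 𝔪 ^ 1))
      refine Ideal.mem_span_singleton'.2 ⟨r, FaithfulSMul.algebraMap_injective R K ?_⟩
      rw [map_mul, hr, map_mul, pow_one]
      field_simp
    obtain ⟨r, hr⟩ := Ideal.mem_span_singleton'.1 ha
    have has : a * s ∈ 𝔪 ^ 2 := Ideal.mul_mem_left _ _ hs
    obtain rfl : c = r * x + a * s := by rw [hr]; ring
    refine (IsLocalization.mem_coeSubmodule _ _).2 ⟨_, Ideal.add_mem _ ?_ has, rfl⟩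
    rw [pow_two]
    refine Ideal.mul_mem_mul ?_ hx.1
    -- If r were a unit, x would lie in R : Λ; as 𝔪²/x² ⊆ Λ, this would give 𝔪² ⊆ xR, hence 𝔪² ⊆ x𝔪.
    by_contra hru
    obtain ⟨d, hd⟩ := (notMem_maximalIdeal.1 hru).exists_left_inv
    have hxC : algebraMap R K x ∈ (1 : Submodule R K) / blowup K 𝔪 := by
      have := Submodule.smul_mem _ d (Submodule.sub_mem _ hz (hsq _ has))
      rwa [← map_sub, add_sub_cancel_right, Algebra.smul_def, ← map_mul, ← mul_assoc, hd,
        one_mul] at this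
    apply h2
    intro w hw
    refine hx.mem_mul_of_mem hm ?_ hw
    obtain ⟨e, he⟩ := (mem_one_div_iff K _ _).1 hxC _ (hx.div_mem_blowup K hx0 hw)
    refine Ideal.mem_span_singleton'.2 ⟨e, FaithfulSMul.algebraMap_injective R K ?_⟩
    rw [map_mul, he]
    field_simp
  · intro z hz
    obtain ⟨q, hq, rfl⟩ := (IsLocalization.mem_coeSubmodule _ _).1 hz
    exact hsq q hq

end Conductor

end BlowUp

/-! ### The equivalence of the three conditions -/

theorem corollary6p10 {R : Type*} [CommRing R] [IsDomain R] [IsLocalRing R] [IsNoetherianRing R]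
    (hdim : ringKrullDim R = 1)
    [Infinite (IsLocalRing.ResidueField R)]
    (K : Type*) [Field K] [Algebra R K] [IsFractionRing R K]
    [Module.Finite R (integralClosure R K)]
    [IsDiscreteValuationRing (integralClosure R K)]
    (hrat : BlowUp.IsResiduallyRational R K)
    (hGor : BlowUp.IsGorensteinLocal R) :
    (∃ x : R, BlowUp.IsMinimalReduction (IsLocalRing.maximalIdeal R) x) ∧
    ∀ x : R, BlowUp.IsMinimalReduction (IsLocalRing.maximalIdeal R) x →
      List.TFAE [
        BlowUp.multiplicity (IsLocalRing.maximalIdeal R) = (BlowUp.embeddingDim R : ℤ) + 1,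
        BlowUp.reductionExponent (IsLocalRing.maximalIdeal R) x = 2,
        (1 : Submodule R K) / BlowUp.blowup K (IsLocalRing.maximalIdeal R) =
          IsLocalization.coeSubmodule K (IsLocalRing.maximalIdeal R) ^ 2] := by
  have hdim1 : Ring.KrullDimLE 1 R := (Order.krullDimLE_iff 1 _).2 hdim.le
  have hm : IsLocalRing.maximalIdeal R ≠ ⊥ := by
    intro h
    have := ringKrullDim_eq_zero_of_isField (IsLocalRing.isField_iff_maximalIdeal_eq.2 h)
    rw [hdim] at this
    exact one_ne_zero this
  have hinj : Function.Injective (algebraMap R (integralClosure R K)) :=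
    FaithfulSMul.algebraMap_injective R (integralClosure R K)
  refine ⟨BlowUp.exists_isMinimalReduction hinj _, fun x hx => ?_⟩
  have hcov := (BlowUp.multiplicity_eq_embeddingDim_add_one_iff hm hx).trans
    (hx.covBy_iff hm hGor)
  tfae_have 1 → 2 := fun h =>
    (BlowUp.reductionExponent_eq_two_iff hx).2
      ⟨hx.pow_three_eq (V := integralClosure R K) K hm hGor (hcov.1 h).1 (hcov.1 h).2,
        (hcov.1 h).2⟩
  tfae_have 2 → 3 := fun h => by
    obtain ⟨h3, h2⟩ := (BlowUp.reductionExponent_eq_two_iff hx).1 h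
    exact hx.conductor_eq K hm hGor h3 h2
  tfae_have 3 → 1 := fun h => hcov.2 (hx.pow_three_le_of_conductor_eq K hm h)
  tfae_finish
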